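/- For an integer $N\ge 2$ let $\varphi(N)$ be Euler's totient, let $r_1,\dots,r_{\varphi(N)}$ be the integers in $\{1,\dots,N\}$ coprime to $N$, and put $$C_N=N^{\varphi(N)}\prod_{p\mid N}p^{\varphi(N)/(p-1)},\qquad \mathbf B_N(m)=C_N^m\prod_{j=1}^{\varphi(N)}\frac{(r_j/N)_m}{m!},\qquad \mathbf H_N(m)=\sum_{j=1}^{\varphi(N)}H(r_j/N,m)-\varphi(N)H(1,m),$$ where $p$ runs over primes, $(\alpha)_m=\alpha(\alpha+1)\cdots(\alpha+m-1)$ with $(\alpha)_0=1$, and $H(x,m)=\sum_{n=0}^{m-1}\frac1{x+n}$. For $\mathbf N=(N_1,\dots,N_k)$ with all $N_j\ge2$ put $C_{\mathbf N}=\prod_j C_{N_j}$, $\Phi_{\mathbf N}=\sum_j\varphi(N_j)$, $M_{\mathbf N}=\max_j N_j$, $\mathbf B_{\mathbf N}(m)=\prod_j\mathbf B_{N_j}(m)$, $\mathbf H_{\mathbf N}(m)=\sum_j\mathbf H_{N_j}(m)$, and $$\mathbf F_{\mathbf N}(z)=\sum_{m\ge0}\mathbf B_{\mathbf N}(m)z^m,\qquad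 \mathbf G_{\mathbf N}(z)=\sum_{m\ge1}\mathbf H_{\mathbf N}(m)\mathbf B_{\mathbf N}(m)z^m,\qquad \mathbf q_{\mathbf N}(z)=z\exp\bigl(\mathbf G_{\mathbf N}(z)/\mathbf F_{\mathbf N}(z)\bigr).$$ Let $N_1,\dots,N_k\ge2$ be integers with $\Phi_{\mathbf N}\ge4$. Then the series $\mathbf F_{\mathbf N}(z)$ and $\mathbf G_{\mathbf N}(z)$ converge at $z=1/C_{\mathbf N}$, and $$\exp\bigl(-\pi\cot(\pi/M_{\mathbf N})\bigr)>\mathbf q_{\mathbf N}(1/C_{\mathbf N}).$$ -/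

import Mathlib

noncomputable section

namespace MirrorMap

/-- The integers in `{1, …, N}` that are coprime to `N`. -/
def residues (N : ℕ) : Finset ℕ := (Finset.Icc 1 N).filter fun r => Nat.Coprime r N

/-- `C_N = N ^ φ(N) * ∏_{p ∣ N} p ^ (φ(N) / (p - 1))`, the product being over primes; each
division in the exponent is exact. -/
def C₁ (N : ℕ) : ℕ :=
  N ^ Nat.totient N * ∏ p ∈ N.primeFactors, p ^ (Nat.totient N / (p - 1))

/-- `B_N(m) = C_N ^ m * ∏_r (r / N)_m / m!`, with `(α)_m` the rising factorial. -/
def B₁ (N m : ℕ) : ℝ :=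
  (C₁ N : ℝ) ^ m *
    ∏ r ∈ residues N, (ascPochhammer ℝ m).eval ((r : ℝ) / (N : ℝ)) / (Nat.factorial m : ℝ)

/-- `H(x, m) = ∑_{n=0}^{m-1} 1 / (x + n)`. -/
def harm (x : ℝ) (m : ℕ) : ℝ := ∑ n ∈ Finset.range m, 1 / (x + (n : ℝ))

/-- `H_N(m) = ∑_r H(r / N, m) - φ(N) H(1, m)`. -/
def H₁ (N m : ℕ) : ℝ :=
  (∑ r ∈ residues N, harm ((r : ℝ) / (N : ℝ)) m) - (Nat.totient N : ℝ) * harm 1 m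

variable {k : ℕ}

/-- `C_𝐍 = C_{N_1} ⋯ C_{N_k}`. -/
def C (N : Fin k → ℕ) : ℕ := ∏ j, C₁ (N j)

/-- `Φ_𝐍 = φ(N_1) + ⋯ + φ(N_k)`. -/
def Phi (N : Fin k → ℕ) : ℕ := ∑ j, Nat.totient (N j)

/-- `M_𝐍 = max(N_1, …, N_k)`. -/
def M (N : Fin k → ℕ) : ℕ := Finset.univ.sup N

/-- `B_𝐍(m) = ∏_j B_{N_j}(m)`. -/
def B (N : Fin k → ℕ) (m : ℕ) : ℝ := ∏ j, B₁ (N j) m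

/-- `H_𝐍(m) = ∑_j H_{N_j}(m)`. -/
def H (N : Fin k → ℕ) (m : ℕ) : ℝ := ∑ j, H₁ (N j) m

/-- `F_𝐍(z) = ∑_{m ≥ 0} B_𝐍(m) z ^ m`, for real `z`. -/
def F (N : Fin k → ℕ) (z : ℝ) : ℝ := ∑' m : ℕ, B N m * z ^ m

/-- `G_𝐍(z) = ∑_{m ≥ 1} H_𝐍(m) B_𝐍(m) z ^ m`, for real `z`; the term `m = 0` included here
vanishes, because `H_𝐍(0) = 0`. -/
def G (N : Fin k → ℕ) (z : ℝ) : ℝ := ∑' m : ℕ, H N m * B N m * z ^ m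

/-- The canonical coordinate `q_𝐍(z) = z * exp (G_𝐍(z) / F_𝐍(z))`, for real `z`. -/
def q (N : Fin k → ℕ) (z : ℝ) : ℝ := z * Real.exp (G N z / F N z)

end MirrorMap

end

/-!
Put `b m = B N m / C N ^ m`. Since `H N m` increases from `0` to `log (C N)`, at `z = 1 / C N` we
have `G ≤ (F - 1) log (C N)`, hence `q ≤ exp (-log (C N) / F)`. It remains to see that
`log (C N) / F ≥ M N`, because `x cot x < 1` gives `π cot (π / M) < M`. Pairing each residue `r`
with `N - r` and comparing both with `N / 2` yields `b m ≤ 1 / (M m (m + 1))` for `m ≥ 1`, so that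
`F ≤ 1 + 1 / M`, while the pairing in `H N 1` gives `log (C N) ≥ H N 1 ≥ M + Φ - 3 ≥ M + 1`.

The limit of `H N m` comes from sieving the harmonic sum by the prime factors of `N`, one prime at
a time.
-/

namespace MirrorMap

open Filter Finset Topology

/-! ### Sums and products over a set with an involution -/

section Involution

variable {ι R : Type*} [CommSemiring R] [PartialOrder R] [IsOrderedRing R] {s : Finset ι}
  {σ : ι → ι} {f : ι → R} {a : R}

lemma card_mul_le_two_mul_sum_of_involution (hσs : ∀ i ∈ s, σ i ∈ s)
    (hσ : ∀ i ∈ s, σ (σ i) = i) (h : ∀ i ∈ s, a ≤ f i + f (σ i)) :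
    #s * a ≤ 2 * ∑ i ∈ s, f i := by
  have hf : ∑ i ∈ s, f (σ i) = ∑ i ∈ s, f i :=
    sum_nbij' σ σ hσs hσs hσ hσ fun _ _ ↦ rfl
  calc #s * a = #s • a := (nsmul_eq_mul _ _).symm
    _ ≤ ∑ i ∈ s, (f i + f (σ i)) := card_nsmul_le_sum _ _ _ h
    _ = 2 * ∑ i ∈ s, f i := by rw [sum_add_distrib, hf, two_mul]

lemma sq_prod_le_pow_card_of_involution (hσs : ∀ i ∈ s, σ i ∈ s)
    (hσ : ∀ i ∈ s, σ (σ i) = i) (hf₀ : ∀ i ∈ s, 0 ≤ f i) (h : ∀ i ∈ s, f i * f (σ i) ≤ a) :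
    (∏ i ∈ s, f i) ^ 2 ≤ a ^ #s := by
  have hf : ∏ i ∈ s, f (σ i) = ∏ i ∈ s, f i :=
    prod_nbij' σ σ hσs hσs hσ hσ fun _ _ ↦ rfl
  calc (∏ i ∈ s, f i) ^ 2 = ∏ i ∈ s, f i * f (σ i) := by rw [prod_mul_distrib, hf, sq]
    _ ≤ ∏ _i ∈ s, a :=
      prod_le_prod (fun i hi ↦ mul_nonneg (hf₀ i hi) (hf₀ _ (hσs i hi))) h
    _ = a ^ #s := prod_const a

end Involution

/-! ### Sieved harmonic sums -/

/-- The harmonic sum of the integers `0 < k ≤ X` that no element of `P` divides. For the set `P` of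
prime factors of `N` these are the `k` coprime to `N`; allowing any `P` makes it possible to remove
one prime at a time. -/
noncomputable def sievedHarmonic (P : Finset ℕ) (X : ℕ) : ℝ :=
  ∑ k ∈ Ioc 0 X with ∀ p ∈ P, ¬ p ∣ k, 1 / (k : ℝ)

lemma sievedHarmonic_empty (X : ℕ) : sievedHarmonic ∅ X = (harmonic X : ℝ) := by
  rw [sievedHarmonic, harmonic_eq_sum_Icc]
  simp [← Icc_add_one_left_eq_Ioc]

lemma sum_sieved_dvd {P : Finset ℕ} {p : ℕ} (hP : ∀ q ∈ P, q.Prime) (hp : p.Prime) (hpP : p ∉ P)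
    (X : ℕ) :
    ∑ k ∈ Ioc 0 (p * X) with (∀ q ∈ P, ¬ q ∣ k) ∧ p ∣ k, 1 / (k : ℝ) =
      1 / (p : ℝ) * sievedHarmonic P X := by
  have hdvd : ∀ q ∈ P, ∀ l, q ∣ p * l ↔ q ∣ l := fun q hq l ↦
    ((Nat.coprime_primes (hP q hq) hp).2 (ne_of_mem_of_not_mem hq hpP)).dvd_mul_left
  have himage : {k ∈ Ioc 0 (p * X) | (∀ q ∈ P, ¬ q ∣ k) ∧ p ∣ k} =
      {l ∈ Ioc 0 X | ∀ q ∈ P, ¬ q ∣ l}.image (p * ·) := by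
    ext k
    simp only [mem_filter, mem_Ioc, mem_image]
    constructor
    · rintro ⟨⟨hk₀, hkX⟩, hkP, l, rfl⟩
      exact ⟨l, ⟨⟨Nat.pos_of_mul_pos_left hk₀, Nat.le_of_mul_le_mul_left hkX hp.pos⟩,
        fun q hq ↦ (hdvd q hq l).not.1 (hkP q hq)⟩, rfl⟩
    · rintro ⟨l, ⟨⟨hl₀, hlX⟩, hlP⟩, rfl⟩
      exact ⟨⟨Nat.mul_pos hp.pos hl₀, Nat.mul_le_mul_left p hlX⟩,
        fun q hq ↦ (hdvd q hq l).not.2 (hlP q hq), dvd_mul_right p l⟩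
  rw [himage, sum_image fun a _ b _ hab ↦ Nat.eq_of_mul_eq_mul_left hp.pos hab, sievedHarmonic,
    mul_sum]
  exact sum_congr rfl fun l _ ↦ by rw [Nat.cast_mul, one_div_mul_one_div]

lemma sievedHarmonic_insert {P : Finset ℕ} {p : ℕ} (hP : ∀ q ∈ P, q.Prime) (hp : p.Prime)
    (hpP : p ∉ P) (X : ℕ) :
    sievedHarmonic (insert p P) (p * X) =
      sievedHarmonic P (p * X) - 1 / (p : ℝ) * sievedHarmonic P X := by
  rw [eq_sub_iff_add_eq, ← sum_sieved_dvd hP hp hpP, add_comm, sievedHarmonic, sievedHarmonic,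
    ← sum_filter_add_sum_filter_not {k ∈ Ioc 0 (p * X) | ∀ q ∈ P, ¬ q ∣ k} (p ∣ ·),
    filter_filter, filter_filter]
  simp only [forall_mem_insert, and_comm]

lemma tendsto_harmonic_mul_sub_harmonic {D : ℕ} (hD : 0 < D) :
    Tendsto (fun m : ℕ ↦ (harmonic (D * m) - harmonic m : ℝ)) atTop (𝓝 (Real.log D)) := by
  have hlog := Real.tendsto_harmonic_sub_log
  have hmul : Tendsto (fun m : ℕ ↦ D * m) atTop atTop := tendsto_id.const_mul_atTop' hD
  have hdiff := ((hlog.comp hmul).sub hlog).add_const (Real.log D)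
  rw [sub_self, zero_add] at hdiff
  refine hdiff.congr' ?_
  filter_upwards [eventually_gt_atTop 0] with m hm
  rw [Function.comp_apply, Nat.cast_mul, Real.log_mul (by positivity) (by positivity)]
  ring

lemma tendsto_sievedHarmonic_sub {P : Finset ℕ} (hP : ∀ p ∈ P, p.Prime) {D : ℕ} (hD : 0 < D)
    (hPD : ∏ p ∈ P, p ∣ D) :
    Tendsto
      (fun m : ℕ ↦ sievedHarmonic P (D * m) - (∏ p ∈ P, (1 - 1 / (p : ℝ))) * (harmonic m : ℝ))
      atTop
      (𝓝 ((∏ p ∈ P, (1 - 1 / (p : ℝ))) *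
        (Real.log D + ∑ p ∈ P, Real.log p / ((p : ℝ) - 1)))) := by
  induction P using Finset.induction_on generalizing D with
  | empty =>
    simpa only [prod_empty, sum_empty, add_zero, one_mul, sievedHarmonic_empty]
      using tendsto_harmonic_mul_sub_harmonic hD
  | insert p P hpP ih =>
    obtain ⟨hp, hP⟩ := (forall_mem_insert _ _ _).1 hP
    rw [prod_insert hpP] at hPD
    obtain ⟨E, rfl⟩ := (dvd_mul_right p _).trans hPD
    have hE : 0 < E := Nat.pos_of_mul_pos_left hD
    have hPE : ∏ q ∈ P, q ∣ E := Nat.dvd_of_mul_dvd_mul_left hp.pos hPD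
    have hp₁ : (1 : ℝ) < p := mod_cast hp.one_lt
    have hp₁' : (p : ℝ) - 1 ≠ 0 := by linarith
    convert (ih hP hD (hPE.mul_left p)).sub ((ih hP hE hPE).const_mul (1 / (p : ℝ))) using 1
    · ext m
      rw [mul_assoc p E m, sievedHarmonic_insert hP hp hpP, prod_insert hpP]
      ring
    · rw [prod_insert hpP, sum_insert hpP, Nat.cast_mul,
        Real.log_mul (by positivity) (by positivity)]
      congr 1
      field_simp
      ring

lemma coprime_iff_forall_primeFactors {N : ℕ} (hN : N ≠ 0) (r : ℕ) :
    r.Coprime N ↔ ∀ p ∈ N.primeFactors, ¬ p ∣ r := by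
  refine ⟨fun h p hp hpr ↦ ?_, fun h ↦ Nat.coprime_of_dvd fun p hp hpr hpN ↦ ?_⟩
  · exact Nat.not_coprime_of_dvd_of_dvd (Nat.prime_of_mem_primeFactors hp).one_lt hpr
      (Nat.dvd_of_mem_primeFactors hp) h
  · exact h p (hp.mem_primeFactors hpN hN) hpr

/-! ### Residues -/

lemma mem_residues {N r : ℕ} : r ∈ residues N ↔ (1 ≤ r ∧ r ≤ N) ∧ r.Coprime N := by
  rw [residues, mem_filter, mem_Icc]

lemma card_residues (N : ℕ) : #(residues N) = N.totient := by
  rw [← Nat.filter_coprime_Ico_eq_totient N 1, residues, add_comm, Ico_add_one_right_eq_Icc]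
  simp only [Nat.coprime_comm]

lemma one_mem_residues {N : ℕ} (hN : 1 ≤ N) : 1 ∈ residues N :=
  mem_residues.2 ⟨⟨le_rfl, hN⟩, Nat.coprime_one_left N⟩

lemma lt_of_mem_residues {N r : ℕ} (hN : 2 ≤ N) (hr : r ∈ residues N) : r < N := by
  obtain ⟨⟨-, hrN⟩, hcop⟩ := mem_residues.1 hr
  refine hrN.lt_of_ne ?_
  rintro rfl
  have := (Nat.coprime_self r).1 hcop
  omega

lemma sub_mem_residues {N r : ℕ} (hN : 2 ≤ N) (hr : r ∈ residues N) : N - r ∈ residues N := by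
  have hlt := lt_of_mem_residues hN hr
  exact mem_residues.2
    ⟨by omega, (Nat.coprime_self_sub_left hlt.le).2 (mem_residues.1 hr).2⟩

lemma div_pos_of_mem_residues {N r : ℕ} (hr : r ∈ residues N) : 0 < (r : ℝ) / N := by
  obtain ⟨⟨hr₁, hrN⟩, -⟩ := mem_residues.1 hr
  exact div_pos (mod_cast hr₁) (mod_cast hr₁.trans hrN)

lemma div_le_one_of_mem_residues {N r : ℕ} (hr : r ∈ residues N) : (r : ℝ) / N ≤ 1 :=
  div_le_one_of_le₀ (mod_cast (mem_residues.1 hr).1.2) N.cast_nonneg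

lemma div_lt_one_of_mem_residues {N r : ℕ} (hN : 2 ≤ N) (hr : r ∈ residues N) :
    (r : ℝ) / N < 1 :=
  (div_lt_one (by positivity)).2 (mod_cast lt_of_mem_residues hN hr)

lemma cast_sub_div {N r : ℕ} (hN : N ≠ 0) (hr : r ≤ N) :
    ((N - r : ℕ) : ℝ) / N = 1 - (r : ℝ) / N := by
  rw [Nat.cast_sub hr, sub_div, div_self (by positivity)]

lemma one_sub_one_subset_residues {N : ℕ} (hN : 2 ≤ N) : {1, N - 1} ⊆ residues N := by
  have h₁ := one_mem_residues (one_le_two.trans hN)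
  exact insert_subset h₁ (singleton_subset_iff.2 (sub_mem_residues hN h₁))

@[to_additive]
lemma prod_residues {α : Type*} [CommMonoid α] {N : ℕ} (hN : 3 ≤ N) (f : ℕ → α) :
    ∏ r ∈ residues N, f r = f 1 * f (N - 1) * ∏ r ∈ residues N \ {1, N - 1}, f r := by
  rw [← prod_pair (show 1 ≠ N - 1 by omega), mul_comm,
    prod_sdiff (one_sub_one_subset_residues (by omega))]

lemma card_residues_sdiff {N : ℕ} (hN : 3 ≤ N) :
    #(residues N \ {1, N - 1}) + 2 = N.totient := by
  rw [← card_residues, ← card_pair (show 1 ≠ N - 1 by omega),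
    card_sdiff_add_card_eq_card (one_sub_one_subset_residues (by omega))]

lemma sub_mem_residues_sdiff {N r : ℕ} (hN : 2 ≤ N) (hr : r ∈ residues N \ {1, N - 1}) :
    N - r ∈ residues N \ {1, N - 1} := by
  simp only [Finset.mem_sdiff, mem_insert, mem_singleton] at hr ⊢
  have := lt_of_mem_residues hN hr.1
  exact ⟨sub_mem_residues hN hr.1, by omega⟩

lemma sum_coprime_Ioc_mul {α : Type*} [AddCommMonoid α] (f : ℕ → α) (N m : ℕ) :
    ∑ k ∈ Ioc 0 (N * m) with k.Coprime N, f k =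
      ∑ n ∈ range m, ∑ r ∈ residues N, f (N * n + r) := by
  induction m with
  | zero => simp
  | succ m ih =>
    have hshift : Ioc (N * m) (N * (m + 1)) = (Ioc 0 N).image (N * m + ·) := by
      rw [image_add_left_Ioc, add_zero, mul_add_one]
    have hblock : ∑ k ∈ Ioc (N * m) (N * (m + 1)) with k.Coprime N, f k =
        ∑ r ∈ residues N, f (N * m + r) := by
      rw [hshift, filter_image, sum_image (add_right_injective _).injOn, residues,
        ← Icc_add_one_left_eq_Ioc]
      simp only [Nat.coprime_mul_left_add_left, zero_add]
    rw [sum_range_succ, ← ih, ← hblock]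
    simp only [sum_filter]
    exact (sum_Ioc_consecutive _ (Nat.zero_le _) (Nat.mul_le_mul_left N m.le_succ)).symm

/-! ### The harmonic numbers of `N` -/

lemma harm_one (m : ℕ) : harm 1 m = (harmonic m : ℝ) := by
  simp [harm, harmonic, add_comm]

lemma sum_harm_residues {N : ℕ} (hN : N ≠ 0) (m : ℕ) :
    ∑ r ∈ residues N, harm ((r : ℝ) / N) m = N * sievedHarmonic N.primeFactors (N * m) := by
  simp only [sievedHarmonic, ← coprime_iff_forall_primeFactors hN]
  rw [sum_coprime_Ioc_mul, mul_sum]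
  simp only [harm, mul_sum]
  rw [sum_comm]
  refine sum_congr rfl fun n _ ↦ sum_congr rfl fun r _ ↦ ?_
  push_cast
  rw [div_add' _ _ _ (by positivity), one_div_div, mul_one_div, add_comm, mul_comm (n : ℝ)]

lemma totient_eq_mul_prod (N : ℕ) :
    (N.totient : ℝ) = N * ∏ p ∈ N.primeFactors, (1 - 1 / (p : ℝ)) := by
  simpa using congrArg (Rat.cast : ℚ → ℝ) (Nat.totient_eq_mul_prod_factors N)

lemma C₁_pos {N : ℕ} (hN : 0 < N) : 0 < C₁ N :=
  Nat.mul_pos (Nat.pow_pos hN)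
    (prod_pos fun _ hp ↦ Nat.pow_pos (Nat.prime_of_mem_primeFactors hp).pos)

lemma cast_totient_div_pred {N p : ℕ} (hp : p ∈ N.primeFactors) :
    ((N.totient / (p - 1) : ℕ) : ℝ) = N.totient / ((p : ℝ) - 1) := by
  have hpp := Nat.prime_of_mem_primeFactors hp
  have hdvd : p - 1 ∣ N.totient := by
    rw [← Nat.totient_prime hpp]
    exact Nat.totient_dvd_of_dvd (Nat.dvd_of_mem_primeFactors hp)
  rw [Nat.cast_div_charZero hdvd, Nat.cast_pred hpp.pos]

lemma log_C₁ {N : ℕ} (hN : 0 < N) :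
    Real.log (C₁ N) =
      N.totient * (Real.log N + ∑ p ∈ N.primeFactors, Real.log p / ((p : ℝ) - 1)) := by
  have hpow : ∀ p ∈ N.primeFactors, (p : ℝ) ^ (N.totient / (p - 1)) ≠ 0 := fun p hp ↦
    pow_ne_zero _ (mod_cast (Nat.prime_of_mem_primeFactors hp).ne_zero)
  rw [C₁]
  push_cast
  rw [Real.log_mul (by positivity) (prod_ne_zero_iff.2 hpow), Real.log_prod hpow, Real.log_pow,
    mul_add, mul_sum]
  congr 1
  refine sum_congr rfl fun p hp ↦ ?_
  rw [Real.log_pow, cast_totient_div_pred hp, div_mul_eq_mul_div, mul_div_assoc]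

lemma tendsto_H₁ {N : ℕ} (hN : 0 < N) : Tendsto (H₁ N) atTop (𝓝 (Real.log (C₁ N))) := by
  have h := (tendsto_sievedHarmonic_sub (fun p hp ↦ Nat.prime_of_mem_primeFactors hp) hN
    (Nat.prod_primeFactors_dvd N)).const_mul (N : ℝ)
  rw [← mul_assoc, ← totient_eq_mul_prod, ← log_C₁ hN] at h
  refine h.congr fun m ↦ ?_
  rw [H₁, sum_harm_residues hN.ne', harm_one, totient_eq_mul_prod]
  ring

lemma H₁_eq_sum_range (N m : ℕ) :
    H₁ N m =
      ∑ n ∈ range m, ∑ r ∈ residues N, (1 / ((r : ℝ) / N + n) - 1 / (1 + (n : ℝ))) := by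
  simp only [H₁, harm, sum_sub_distrib, sum_const, card_residues, nsmul_eq_mul, mul_sum]
  rw [sum_comm]

lemma monotone_H₁ (N : ℕ) : Monotone (H₁ N) := by
  refine monotone_nat_of_le_succ fun m ↦ ?_
  rw [H₁_eq_sum_range, H₁_eq_sum_range, sum_range_succ]
  refine le_add_of_nonneg_right (sum_nonneg fun r hr ↦ sub_nonneg.2 ?_)
  have := div_pos_of_mem_residues hr
  have := div_le_one_of_mem_residues hr
  gcongr

lemma H₁_zero (N : ℕ) : H₁ N 0 = 0 := by simp [H₁, harm]

lemma H₁_one (N : ℕ) : H₁ N 1 = ∑ r ∈ residues N, (1 / ((r : ℝ) / N) - 1) := by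
  simp [H₁_eq_sum_range]

lemma four_le_one_div_add_one_div_one_sub {x : ℝ} (h₀ : 0 < x) (h₁ : x < 1) :
    4 ≤ 1 / x + 1 / (1 - x) := by
  have : 0 < 1 - x := sub_pos.2 h₁
  rw [div_add_div _ _ h₀.ne' this.ne', le_div_iff₀ (by positivity)]
  linarith [sq_nonneg (2 * x - 1)]

lemma card_le_sum_one_div_sub_one {N : ℕ} (hN : 2 ≤ N) {s : Finset ℕ} (hs : s ⊆ residues N)
    (hrefl : ∀ r ∈ s, N - r ∈ s) : (#s : ℝ) ≤ ∑ r ∈ s, (1 / ((r : ℝ) / N) - 1) := by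
  have hle : ∀ r ∈ s, r ≤ N := fun r hr ↦ (lt_of_mem_residues hN (hs hr)).le
  have h := card_mul_le_two_mul_sum_of_involution (a := (2 : ℝ))
    (f := fun r : ℕ ↦ 1 / ((r : ℝ) / N) - 1) hrefl (fun r hr ↦ Nat.sub_sub_self (hle r hr))
    fun r hr ↦ by
      rw [cast_sub_div (by omega) (hle r hr)]
      linarith [four_le_one_div_add_one_div_one_sub (div_pos_of_mem_residues (hs hr))
        (div_lt_one_of_mem_residues hN (hs hr))]
  linarith

lemma totient_le_H₁_one {N : ℕ} (hN : 2 ≤ N) : (N.totient : ℝ) ≤ H₁ N 1 := by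
  rw [H₁_one, ← card_residues]
  exact card_le_sum_one_div_sub_one hN Subset.rfl fun r hr ↦ sub_mem_residues hN hr

lemma add_totient_sub_three_le_H₁_one {N : ℕ} (hN : 2 ≤ N) :
    (N : ℝ) + N.totient - 3 ≤ H₁ N 1 := by
  obtain rfl | hN₃ := hN.eq_or_lt
  · have := totient_le_H₁_one hN
    push_cast
    linarith
  · have hcard : (#(residues N \ {1, N - 1}) : ℝ) + 2 = N.totient :=
      mod_cast card_residues_sdiff hN₃
    have hinner := card_le_sum_one_div_sub_one hN sdiff_subset fun r hr ↦
      sub_mem_residues_sdiff hN hr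
    have hlast := sub_mem_residues hN (one_mem_residues (one_le_two.trans hN))
    have hlast' := one_le_one_div (div_pos_of_mem_residues hlast)
      (div_le_one_of_mem_residues hlast)
    rw [H₁_one, sum_residues hN₃, Nat.cast_one, one_div_one_div]
    linarith

/-! ### Normalised coefficients -/

/-- `(x)_m / m!`, the factor of `B₁` belonging to the parameter `x`. -/
noncomputable def pochRatio (x : ℝ) (m : ℕ) : ℝ :=
  (ascPochhammer ℝ m).eval x / (m.factorial : ℝ)

lemma pochRatio_zero (x : ℝ) : pochRatio x 0 = 1 := by simp [pochRatio]

lemma pochRatio_succ (x : ℝ) (m : ℕ) :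
    pochRatio x (m + 1) = pochRatio x m * ((x + m) / (m + 1)) := by
  rw [pochRatio, pochRatio, ascPochhammer_succ_eval, Nat.factorial_succ, div_mul_div_comm,
    Nat.cast_mul, Nat.cast_succ, mul_comm ((m : ℝ) + 1)]

lemma pochRatio_pos {x : ℝ} (hx : 0 < x) (m : ℕ) : 0 < pochRatio x m :=
  div_pos (ascPochhammer_pos m x hx) (by positivity)

lemma pochRatio_half_pos (m : ℕ) : 0 < pochRatio (1 / 2) m := pochRatio_pos one_half_pos m

lemma pochRatio_half_sq_le (m : ℕ) : pochRatio (1 / 2) m ^ 2 ≤ 1 / (2 * m + 1) := by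
  induction m with
  | zero => simp [pochRatio_zero]
  | succ m ih =>
    calc pochRatio (1 / 2) (m + 1) ^ 2
        = pochRatio (1 / 2) m ^ 2 * ((1 / 2 + (m : ℝ)) / (m + 1)) ^ 2 := by
          rw [pochRatio_succ, mul_pow]
      _ ≤ 1 / (2 * (m : ℝ) + 1) * ((1 / 2 + (m : ℝ)) / (m + 1)) ^ 2 := by gcongr
      _ = (2 * (m : ℝ) + 1) / (2 * m + 2) ^ 2 := by field_simp; ring
      _ ≤ 1 / (2 * ((m + 1 : ℕ) : ℝ) + 1) := by
        rw [div_le_div_iff₀ (by positivity) (by positivity)]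
        push_cast
        linarith

lemma pochRatio_half_le_one (m : ℕ) : pochRatio (1 / 2) m ≤ 1 := by
  refine (sq_le_one_iff₀ (pochRatio_half_pos m).le).1 ((pochRatio_half_sq_le m).trans ?_)
  rw [div_le_one₀ (by positivity)]
  linarith [m.cast_nonneg (α := ℝ)]

lemma add_mul_one_sub_add_le_half_add_sq {x y : ℝ} : (x + y) * (1 - x + y) ≤ (1 / 2 + y) ^ 2 := by
  linarith [sq_nonneg (x - 1 / 2)]

lemma pochRatio_mul_pochRatio_one_sub_succ_le {x : ℝ} (h₀ : 0 < x) (h₁ : x < 1) (m : ℕ) :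
    pochRatio x (m + 1) * pochRatio (1 - x) (m + 1) ≤
      4 * (x * (1 - x)) * pochRatio (1 / 2) (m + 1) ^ 2 := by
  have : 0 < 1 - x := sub_pos.2 h₁
  induction m with
  | zero =>
    refine le_of_eq ?_
    simp only [pochRatio_succ, pochRatio_zero, Nat.cast_zero]
    ring
  | succ m ih =>
    rw [pochRatio_succ x (m + 1), pochRatio_succ (1 - x) (m + 1), pochRatio_succ (1 / 2) (m + 1)]
    set y : ℝ := ((m + 1 : ℕ) : ℝ)
    calc pochRatio x (m + 1) * ((x + y) / (y + 1)) *
          (pochRatio (1 - x) (m + 1) * ((1 - x + y) / (y + 1)))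
        = pochRatio x (m + 1) * pochRatio (1 - x) (m + 1) *
            ((x + y) * (1 - x + y) / (y + 1) ^ 2) := by field_simp
      _ ≤ 4 * (x * (1 - x)) * pochRatio (1 / 2) (m + 1) ^ 2 *
            ((1 / 2 + y) ^ 2 / (y + 1) ^ 2) := by
        gcongr ?_ * (?_ / _)
        exact add_mul_one_sub_add_le_half_add_sq
      _ = 4 * (x * (1 - x)) * (pochRatio (1 / 2) (m + 1) * ((1 / 2 + y) / (y + 1))) ^ 2 := by
        rw [mul_pow, div_pow, mul_assoc]

lemma pochRatio_mul_pochRatio_one_sub_le {x : ℝ} (h₀ : 0 < x) (h₁ : x < 1) (m : ℕ) :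
    pochRatio x m * pochRatio (1 - x) m ≤ pochRatio (1 / 2) m ^ 2 := by
  cases m with
  | zero => simp [pochRatio_zero]
  | succ m =>
    refine (pochRatio_mul_pochRatio_one_sub_succ_le h₀ h₁ m).trans ?_
    exact mul_le_of_le_one_left (sq_nonneg _) (by linarith [sq_nonneg (2 * x - 1)])

lemma prod_pochRatio_le_pow_card {N : ℕ} (hN : 2 ≤ N) {s : Finset ℕ} (hs : s ⊆ residues N)
    (hrefl : ∀ r ∈ s, N - r ∈ s) (m : ℕ) :
    ∏ r ∈ s, pochRatio ((r : ℝ) / N) m ≤ pochRatio (1 / 2) m ^ #s := by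
  have hle : ∀ r ∈ s, r ≤ N := fun r hr ↦ (lt_of_mem_residues hN (hs hr)).le
  refine (abs_le_of_sq_le_sq' ?_ (pow_pos (pochRatio_half_pos m) _).le).2
  rw [pow_right_comm]
  refine sq_prod_le_pow_card_of_involution hrefl (fun r hr ↦ Nat.sub_sub_self (hle r hr))
    (fun r hr ↦ (pochRatio_pos (div_pos_of_mem_residues (hs hr)) m).le) fun r hr ↦ ?_
  rw [cast_sub_div (by omega) (hle r hr)]
  exact pochRatio_mul_pochRatio_one_sub_le (div_pos_of_mem_residues (hs hr))
    (div_lt_one_of_mem_residues hN (hs hr)) m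

/-- `B_N(m) / C_N ^ m`, the coefficient of `z ^ m` after the boundary point is scaled to `1`. -/
noncomputable def normB₁ (N m : ℕ) : ℝ := ∏ r ∈ residues N, pochRatio ((r : ℝ) / N) m

lemma normB₁_pos (N m : ℕ) : 0 < normB₁ N m :=
  prod_pos fun _ hr ↦ pochRatio_pos (div_pos_of_mem_residues hr) m

lemma normB₁_le {N : ℕ} (hN : 2 ≤ N) (m : ℕ) :
    normB₁ N m ≤ pochRatio (1 / 2) m ^ N.totient := by
  rw [← card_residues]
  exact prod_pochRatio_le_pow_card hN Subset.rfl (fun r hr ↦ sub_mem_residues hN hr) m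

lemma normB₁_succ_le {N : ℕ} (hN : 2 ≤ N) (m : ℕ) :
    normB₁ N (m + 1) ≤ 4 / N * pochRatio (1 / 2) (m + 1) ^ N.totient := by
  obtain rfl | hN₃ := hN.eq_or_lt
  · refine (normB₁_le hN (m + 1)).trans (le_mul_of_one_le_left ?_ (by norm_num))
    exact (pow_pos (pochRatio_half_pos _) _).le
  have h₀ : (0 : ℝ) < 1 / N := by positivity
  have h₁ : 1 / (N : ℝ) < 1 := (div_lt_one (by positivity)).2 (mod_cast hN)
  have hc := pochRatio_half_pos (m + 1)
  have hends : pochRatio (1 / N) (m + 1) * pochRatio (1 - 1 / N) (m + 1) ≤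
      4 / N * pochRatio (1 / 2) (m + 1) ^ 2 := by
    refine (pochRatio_mul_pochRatio_one_sub_succ_le h₀ h₁ m).trans ?_
    gcongr
    linarith [mul_le_of_le_one_right h₀.le (sub_le_self 1 h₀.le), mul_one_div 4 (N : ℝ)]
  have hinner := prod_pochRatio_le_pow_card hN sdiff_subset
    (fun r hr ↦ sub_mem_residues_sdiff hN hr) (m + 1)
  rw [normB₁, prod_residues hN₃, cast_sub_div (by omega) (by omega), Nat.cast_one,
    ← card_residues_sdiff hN₃, pow_add, mul_comm (_ ^ #_), ← mul_assoc]
  refine mul_le_mul hends hinner (prod_nonneg fun r hr ↦ ?_) (by positivity)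
  exact (pochRatio_pos (div_pos_of_mem_residues (sdiff_subset hr)) _).le

/-! ### Several parameters -/

/-- `B_𝐍(m) / C_𝐍 ^ m`, the coefficient of `z ^ m` after the boundary point is scaled to `1`. -/
noncomputable def normB {k : ℕ} (N : Fin k → ℕ) (m : ℕ) : ℝ := ∏ j, normB₁ (N j) m

section Tuple

variable {k : ℕ} {N : Fin k → ℕ}

lemma exists_eq_M (hPhi : Phi N ≠ 0) : ∃ i, M N = N i := by
  obtain ⟨i, -, -⟩ := exists_ne_zero_of_sum_ne_zero hPhi
  obtain ⟨i, -, hi⟩ := exists_mem_eq_sup univ ⟨i, mem_univ i⟩ N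
  exact ⟨i, hi⟩

lemma log_C (hN : ∀ j, 0 < N j) : Real.log (C N) = ∑ j, Real.log (C₁ (N j)) := by
  rw [C, Nat.cast_prod, Real.log_prod fun j _ ↦ mod_cast (C₁_pos (hN j)).ne']

lemma C_pos (hN : ∀ j, 0 < N j) : 0 < C N := prod_pos fun j _ ↦ C₁_pos (hN j)

lemma H_zero (N : Fin k → ℕ) : H N 0 = 0 := by simp [H, H₁_zero]

lemma monotone_H (N : Fin k → ℕ) : Monotone (H N) :=
  fun _ _ h ↦ sum_le_sum fun j _ ↦ monotone_H₁ (N j) h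

lemma H_nonneg (N : Fin k → ℕ) (m : ℕ) : 0 ≤ H N m :=
  H_zero N ▸ monotone_H N m.zero_le

lemma tendsto_H (hN : ∀ j, 0 < N j) : Tendsto (H N) atTop (𝓝 (Real.log (C N))) := by
  rw [log_C hN]
  exact tendsto_finsetSum _ fun j _ ↦ tendsto_H₁ (hN j)

lemma H_le_log_C (hN : ∀ j, 0 < N j) (m : ℕ) : H N m ≤ Real.log (C N) :=
  (monotone_H N).ge_of_tendsto (tendsto_H hN) m

lemma M_add_Phi_sub_three_le_H_one (hN : ∀ j, 2 ≤ N j) (hPhi : Phi N ≠ 0) :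
    (M N : ℝ) + Phi N - 3 ≤ H N 1 := by
  obtain ⟨i, hi⟩ := exists_eq_M hPhi
  have hmax := add_totient_sub_three_le_H₁_one (hN i)
  have hrest : ∑ j ∈ univ.erase i, ((N j).totient : ℝ) ≤ ∑ j ∈ univ.erase i, H₁ (N j) 1 :=
    sum_le_sum fun j _ ↦ totient_le_H₁_one (hN j)
  rw [hi, H, Phi, ← add_sum_erase _ _ (mem_univ i), ← add_sum_erase _ _ (mem_univ i)]
  push_cast
  linarith

lemma M_add_one_le_log_C (hN : ∀ j, 2 ≤ N j) (hPhi : 4 ≤ Phi N) :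
    (M N : ℝ) + 1 ≤ Real.log (C N) := by
  have hPhi' : (4 : ℝ) ≤ Phi N := mod_cast hPhi
  linarith [M_add_Phi_sub_three_le_H_one hN (by omega),
    H_le_log_C (fun j ↦ two_pos.trans_le (hN j)) 1]

lemma B_eq_C_pow_mul_normB (N : Fin k → ℕ) (m : ℕ) : B N m = (C N : ℝ) ^ m * normB N m := by
  rw [normB, C, Nat.cast_prod, ← prod_pow, ← prod_mul_distrib]
  rfl

lemma B_mul_inv_C_pow (hN : ∀ j, 0 < N j) (m : ℕ) :
    B N m * (1 / (C N : ℝ)) ^ m = normB N m := by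
  have hC : (C N : ℝ) ^ m ≠ 0 := pow_ne_zero _ (mod_cast (C_pos hN).ne')
  rw [B_eq_C_pow_mul_normB, one_div, inv_pow, mul_comm, inv_mul_cancel_left₀ hC]

lemma normB_pos (N : Fin k → ℕ) (m : ℕ) : 0 < normB N m :=
  prod_pos fun j _ ↦ normB₁_pos (N j) m

lemma normB_zero (N : Fin k → ℕ) : normB N 0 = 1 := by
  simp [normB, normB₁, pochRatio_zero]

lemma normB_succ_le_mul_pow (hN : ∀ j, 2 ≤ N j) (hPhi : Phi N ≠ 0) (m : ℕ) :
    normB N (m + 1) ≤ 4 / M N * pochRatio (1 / 2) (m + 1) ^ Phi N := by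
  obtain ⟨i, hi⟩ := exists_eq_M hPhi
  have hc := pochRatio_half_pos (m + 1)
  have hrest : ∏ j ∈ univ.erase i, normB₁ (N j) (m + 1) ≤
      ∏ j ∈ univ.erase i, pochRatio (1 / 2) (m + 1) ^ (N j).totient :=
    prod_le_prod (fun j _ ↦ (normB₁_pos _ _).le) fun j _ ↦ normB₁_le (hN j) (m + 1)
  rw [normB, Phi, ← prod_pow_eq_pow_sum, ← mul_prod_erase _ _ (mem_univ i),
    ← mul_prod_erase _ _ (mem_univ i), hi, ← mul_assoc]
  exact mul_le_mul (normB₁_succ_le (hN i) m) hrest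
    (prod_nonneg fun j _ ↦ (normB₁_pos _ _).le) (by positivity)

lemma normB_succ_le (hN : ∀ j, 2 ≤ N j) (hPhi : 4 ≤ Phi N) (m : ℕ) :
    normB N (m + 1) ≤ 1 / M N * (1 / ((m + 1) * (m + 2))) := by
  set c := pochRatio (1 / 2) (m + 1)
  have hc : 0 ≤ c := (pochRatio_half_pos _).le
  calc normB N (m + 1) ≤ 4 / M N * c ^ Phi N := normB_succ_le_mul_pow hN (by omega) m
    _ ≤ 4 / M N * c ^ 4 :=
      mul_le_mul_of_nonneg_left (pow_le_pow_of_le_one hc (pochRatio_half_le_one _) hPhi)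
        (by positivity)
    _ = 1 / M N * (4 * (c ^ 2) ^ 2) := by ring
    _ ≤ 1 / M N * (4 * (1 / (2 * (m + 1 : ℕ) + 1)) ^ 2) := by
      gcongr
      exact pochRatio_half_sq_le (m + 1)
    _ ≤ 1 / M N * (1 / ((m + 1) * (m + 2))) := by
      gcongr
      push_cast
      rw [div_pow, mul_div_assoc', div_le_div_iff₀ (by positivity) (by positivity)]
      linarith

end Tuple

/-! ### Values at the boundary point -/

lemma hasSum_one_div_mul_succ :
    HasSum (fun m : ℕ ↦ 1 / (((m : ℝ) + 1) * (m + 2))) 1 := by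
  have hpartial : ∀ n : ℕ,
      ∑ m ∈ range n, 1 / (((m : ℝ) + 1) * (m + 2)) = 1 - 1 / ((n : ℝ) + 1) := fun n ↦ by
    induction n with
    | zero => simp
    | succ n ih =>
      rw [sum_range_succ, ih]
      push_cast
      field_simp
      ring
  rw [hasSum_iff_tendsto_nat_of_nonneg fun m ↦ by positivity]
  simpa only [hpartial, sub_zero] using tendsto_one_div_add_atTop_nhds_zero_nat.const_sub (1 : ℝ)

lemma summable_mul_of_bounded {h b : ℕ → ℝ} {L : ℝ} (hh : ∀ m, 0 ≤ h m) (hL : ∀ m, h m ≤ L)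
    (hb₀ : ∀ m, 0 ≤ b m) (hb : Summable b) : Summable fun m ↦ h m * b m :=
  .of_nonneg_of_le (fun m ↦ mul_nonneg (hh m) (hb₀ m))
    (fun m ↦ mul_le_mul_of_nonneg_right (hL m) (hb₀ m)) (hb.mul_left L)

lemma tsum_mul_le_mul_tsum_sub {h b : ℕ → ℝ} {L : ℝ} (h_zero : h 0 = 0) (hh : ∀ m, 0 ≤ h m)
    (hL : ∀ m, h m ≤ L) (hb₀ : ∀ m, 0 ≤ b m) (hb : Summable b) :
    ∑' m, h m * b m ≤ L * (∑' m, b m - b 0) := by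
  have hb' : Summable fun m ↦ b (m + 1) := (summable_nat_add_iff 1).2 hb
  rw [(summable_mul_of_bounded hh hL hb₀ hb).tsum_eq_zero_add, hb.tsum_eq_zero_add, h_zero,
    zero_mul, zero_add, add_sub_cancel_left, ← tsum_mul_left]
  exact (summable_mul_of_bounded (fun m ↦ hh (m + 1)) (fun m ↦ hL (m + 1))
    (fun m ↦ hb₀ (m + 1)) hb').tsum_le_tsum
    (fun m ↦ mul_le_mul_of_nonneg_right (hL _) (hb₀ _)) (hb'.mul_left L)

lemma mul_cot_lt_one {x : ℝ} (h₀ : 0 < x) (hπ : x < Real.pi) : x * Real.cot x < 1 := by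
  have hsin : 0 < Real.sin x := Real.sin_pos_of_pos_of_lt_pi h₀ hπ
  rw [Real.cot_eq_cos_div_sin, mul_div_assoc', div_lt_one hsin]
  obtain h | h := lt_or_ge x (Real.pi / 2)
  · have hcos : 0 < Real.cos x := Real.cos_pos_of_mem_Ioo ⟨by linarith, h⟩
    have htan := Real.lt_tan h₀ h
    rwa [Real.tan_eq_sin_div_cos, lt_div_iff₀ hcos] at htan
  · have hcos : Real.cos x ≤ 0 := Real.cos_nonpos_of_pi_div_two_le_of_le h (by linarith)
    exact (mul_nonpos_of_nonneg_of_nonpos h₀.le hcos).trans_lt hsin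

lemma pi_mul_cot_pi_div_lt {y : ℝ} (hy : 1 < y) : Real.pi * Real.cot (Real.pi / y) < y := by
  have h := mul_cot_lt_one (div_pos Real.pi_pos (one_pos.trans hy))
    (div_lt_self Real.pi_pos hy)
  rwa [div_mul_eq_mul_div, div_lt_one (one_pos.trans hy)] at h

section Tuple

variable {k : ℕ} {N : Fin k → ℕ}

lemma summable_normB (hN : ∀ j, 2 ≤ N j) (hPhi : 4 ≤ Phi N) : Summable (normB N) :=
  (summable_nat_add_iff 1).1 <| .of_nonneg_of_le (fun _ ↦ (normB_pos N _).le)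
    (normB_succ_le hN hPhi) (hasSum_one_div_mul_succ.summable.mul_left _)

lemma tsum_normB_le (hN : ∀ j, 2 ≤ N j) (hPhi : 4 ≤ Phi N) :
    ∑' m, normB N m ≤ 1 + 1 / M N := by
  have hs := summable_normB hN hPhi
  rw [hs.tsum_eq_zero_add, normB_zero]
  gcongr
  simpa only [mul_one] using hasSum_le (normB_succ_le hN hPhi)
    ((summable_nat_add_iff 1).2 hs).hasSum (hasSum_one_div_mul_succ.mul_left (1 / (M N : ℝ)))

lemma F_one_div_C (hN : ∀ j, 0 < N j) : F N (1 / C N) = ∑' m, normB N m :=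
  tsum_congr (B_mul_inv_C_pow hN)

lemma G_one_div_C (hN : ∀ j, 0 < N j) : G N (1 / C N) = ∑' m, H N m * normB N m :=
  tsum_congr fun m ↦ by rw [mul_assoc, B_mul_inv_C_pow hN]

lemma q_one_div_C_le_exp_neg_M (hN : ∀ j, 2 ≤ N j) (hPhi : 4 ≤ Phi N) :
    q N (1 / C N) ≤ Real.exp (-M N) := by
  have hpos : ∀ j, 0 < N j := fun j ↦ two_pos.trans_le (hN j)
  have hC : (0 : ℝ) < C N := mod_cast C_pos hpos
  have hM : (0 : ℝ) < M N := by
    obtain ⟨i, hi⟩ := exists_eq_M (N := N) (by omega)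
    exact mod_cast hi ▸ hpos i
  have hs := summable_normB hN hPhi
  have hF : 0 < F N (1 / C N) := by
    rw [F_one_div_C hpos]
    exact hs.tsum_pos (fun m ↦ (normB_pos N m).le) 0 (normB_pos N 0)
  have hMF : M N * F N (1 / C N) ≤ Real.log (C N) := by
    calc M N * F N (1 / C N) ≤ M N * (1 + 1 / M N) := by
          rw [F_one_div_C hpos]
          gcongr
          exact tsum_normB_le hN hPhi
      _ = M N + 1 := by field_simp
      _ ≤ Real.log (C N) := M_add_one_le_log_C hN hPhi
  have hG : G N (1 / C N) ≤ Real.log (C N) * (F N (1 / C N) - 1) := by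
    rw [G_one_div_C hpos, F_one_div_C hpos, ← normB_zero N]
    exact tsum_mul_le_mul_tsum_sub (H_zero N) (H_nonneg N) (H_le_log_C hpos)
      (fun m ↦ (normB_pos N m).le) hs
  have hGF : G N (1 / C N) / F N (1 / C N) ≤ Real.log (C N) - M N := by
    rw [div_le_iff₀ hF]
    linarith
  calc q N (1 / C N) ≤ 1 / C N * Real.exp (Real.log (C N) - M N) := by
        rw [q]
        gcongr
    _ = Real.exp (-M N) := by
        rw [sub_eq_add_neg, Real.exp_add, Real.exp_log hC, one_div, inv_mul_cancel_left₀ hC.ne']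

end Tuple

end MirrorMap

/-- The two convergence claims say that the value of `q_𝐍` at the boundary point `1 / C_𝐍` of the
disk of convergence is given by convergent series. -/
theorem lemma9 {k : ℕ} (N : Fin k → ℕ) (hN : ∀ j, 2 ≤ N j) (hPhi : 4 ≤ MirrorMap.Phi N) :
    Summable (fun m : ℕ => MirrorMap.B N m * (1 / (MirrorMap.C N : ℝ)) ^ m) ∧
    Summable (fun m : ℕ =>
      MirrorMap.H N m * MirrorMap.B N m * (1 / (MirrorMap.C N : ℝ)) ^ m) ∧
    Real.exp (-(Real.pi * Real.cot (Real.pi / (MirrorMap.M N : ℝ)))) >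
      MirrorMap.q N (1 / (MirrorMap.C N : ℝ)) := by
  have hpos : ∀ j, 0 < N j := fun j ↦ two_pos.trans_le (hN j)
  have hs := MirrorMap.summable_normB hN hPhi
  refine ⟨?_, ?_, ?_⟩
  · simpa only [MirrorMap.B_mul_inv_C_pow hpos] using hs
  · simpa only [mul_assoc, MirrorMap.B_mul_inv_C_pow hpos] using
      MirrorMap.summable_mul_of_bounded (MirrorMap.H_nonneg N) (MirrorMap.H_le_log_C hpos)
        (fun m ↦ (MirrorMap.normB_pos N m).le) hs
  · obtain ⟨i, hi⟩ := MirrorMap.exists_eq_M (N := N) (by omega)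
    have hM : (1 : ℝ) < MirrorMap.M N := mod_cast hi ▸ hN i
    exact (MirrorMap.q_one_div_C_le_exp_neg_M hN hPhi).trans_lt
      (Real.exp_lt_exp.2 (neg_lt_neg (MirrorMap.pi_mul_cot_pi_div_lt hM)))
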